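/- Let $A$ be an artin algebra (an algebra that is finitely generated as a module over a commutative artinian ring). For integers $a\le b$ let $\mathbf{C}_{[a,b]}(\mathrm{proj}\,A)$ be the full subcategory of the category of cochain complexes of $A$-modules whose objects are the complexes $X=(X^i,d_X^i)_{i\in\mathbb Z}$ with all $X^i$ finitely generated projective and $X^i=0$ for $i\notin\{a,\dots,b\}$, with the exact structure given by the short exact sequences of complexes (equivalently, the sequences that are split exact in each degree). Write $\mathbf{C}_n(\mathrm{proj}\,A)=\mathbf{C}_{[1,n]}(\mathrm{proj}\,A)\subseteq \mathbf{C}_{[0,n]}(\mathrm{proj}\,A)$. Let $n\ge 1$, let $X$ be an indecomposable complex in $\mathbf{C}_n(\mathrm{proj}\,A)$, and let $P_S$ be the projective cover of the socle $\mathrm{soc}(\mathrm{Ker}\,d_X^1)$ of the kernel of $d_X^1:X^1\to X^2$. 1. If $f:X\to Z$ is a left almost split morphism in $\mathbf{C}_{[0,n]}(\mathrm{proj}\,A)$ (that is, $f$ is not a section and every morphism of $\mathbf{C}_{[0,n]}(\mathrm{proj}\,A)$ starting at $X$ that is not a section factors through $f$), then every indecomposable direct summand of $P_S$ is isomorphic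 to a direct summand of $Z^0$. 2. If $X$ is not injective in the exact category $\mathbf{C}_{[0,n]}(\mathrm{proj}\,A)$, then $(\tau^{-1}X)^0\in\mathrm{add}(P_S)$. Here $\tau^{-1}X$ is the inverse Auslander–Reiten translate of $X$ in $\mathbf{C}_{[0,n]}(\mathrm{proj}\,A)$, i.e. the last term of an almost split sequence $0\to X\to E\to\tau^{-1}X\to 0$ (a short exact sequence in the exact structure whose first map is left almost split and whose second map is right almost split), and $\mathrm{add}(P_S)$ is the class of modules isomorphic to finite direct sums of direct summands of $P_S$. -/

import Mathlib

open CategoryTheory CategoryTheory.Limits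

universe u v w

/-! ### Finitely generated projective modules and complexes of them -/

section Complexes

variable (A : Type u) [Ring A]

/-- `C_[a,b](proj A)` as a property of complexes: every term is a finitely generated projective
module, and the terms in degrees outside `{a, …, b}` vanish. -/
def IsBoundedProj (a b : ℤ) : ObjectProperty (CochainComplex (ModuleCat.{u} A) ℤ) := fun X =>
  (∀ i : ℤ, Module.Finite A (X.X i) ∧ Module.Projective A (X.X i)) ∧
    ∀ i : ℤ, i ∉ Set.Icc a b → IsZero (X.X i)

theorem IsBoundedProj.mono {a b a' b' : ℤ} (ha : a' ≤ a) (hb : b ≤ b') :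
    IsBoundedProj A a b ≤ IsBoundedProj A a' b' :=
  fun _ hX => ⟨hX.1, fun i hi => hX.2 i fun h => hi ⟨ha.trans h.1, h.2.trans hb⟩⟩

/-- The category `C_[a,b](proj A)`: a full subcategory of the category of complexes. -/
abbrev BoundedProjComplex (a b : ℤ) : Type (u + 1) := (IsBoundedProj A a b).FullSubcategory

/-- The inclusion of `C_n(proj A) = C_[1,n](proj A)` into `C_[0,n](proj A)`. -/
abbrev inclZero (n : ℕ) : BoundedProjComplex A 1 n ⥤ BoundedProjComplex A 0 n :=
  ObjectProperty.ιOfLE (IsBoundedProj.mono A zero_le_one le_rfl)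

instance (a b : ℤ) : (IsBoundedProj A a b).IsClosedUnderBinaryProducts where
  limitsOfShape_le := by
    rintro Y ⟨p⟩
    let X₁ := p.diag.obj ⟨WalkingPair.left⟩
    let X₂ := p.diag.obj ⟨WalkingPair.right⟩
    have h₁ : IsBoundedProj A a b X₁ := p.prop_diag_obj _
    have h₂ : IsBoundedProj A a b X₂ := p.prop_diag_obj _
    let e : Y ≅ X₁ ⊞ X₂ :=
      IsLimit.conePointsIsoOfNatIso p.isLimit (BinaryBiproduct.isLimit X₁ X₂)
        (diagramIsoPair p.diag)
    let ei (i : ℤ) : Y.X i ≅ ModuleCat.of A (X₁.X i × X₂.X i) :=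
      (HomologicalComplex.eval _ _ i).mapIso e ≪≫ HomologicalComplex.biprodXIso X₁ X₂ i ≪≫
        ModuleCat.biprodIsoProd _ _
    refine ⟨fun i => ?_, fun i hi => ?_⟩
    · have := (h₁.1 i).1
      have := (h₁.1 i).2
      have := (h₂.1 i).1
      have := (h₂.1 i).2
      exact ⟨Module.Finite.equiv (ei i).toLinearEquiv.symm,
        Module.Projective.of_equiv (ei i).toLinearEquiv.symm⟩
    · have := ModuleCat.subsingleton_of_isZero (h₁.2 i hi)
      have := ModuleCat.subsingleton_of_isZero (h₂.2 i hi)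
      exact (ModuleCat.isZero_of_subsingleton (ModuleCat.of A (X₁.X i × X₂.X i))).of_iso (ei i)

instance (a b : ℤ) : HasBinaryBiproducts (BoundedProjComplex A a b) :=
  HasBinaryBiproducts.of_hasBinaryProducts

end Complexes

/-! ### Almost split morphisms -/

section AlmostSplit

variable {C : Type v} [Category.{w} C]

/-- `f : X ⟶ Z` is left almost split: it is not a section, and every morphism starting at `X`
that is not a section factors through `f`. -/
def IsLeftAlmostSplit {X Z : C} (f : X ⟶ Z) : Prop :=
  ¬ IsSplitMono f ∧ ∀ ⦃W : C⦄ (g : X ⟶ W), ¬ IsSplitMono g → ∃ h : Z ⟶ W, f ≫ h = g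

/-- `g : Z ⟶ Y` is right almost split: it is not a retraction, and every morphism ending at `Y`
that is not a retraction factors through `g`. -/
def IsRightAlmostSplit {Z Y : C} (g : Z ⟶ Y) : Prop :=
  ¬ IsSplitEpi g ∧ ∀ ⦃W : C⦄ (k : W ⟶ Y), ¬ IsSplitEpi k → ∃ h : W ⟶ Z, h ≫ g = k

end AlmostSplit

/-! ### The exact structure of `C_[a,b](proj A)` -/

section Exact

variable {A : Type u} [Ring A] {a b : ℤ}

/-- The conflations of the exact category `C_[a,b](proj A)`: the sequences `X ⟶ E ⟶ Y` that are
short exact as sequences of complexes of modules (equivalently, split exact in each degree,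
because the terms of `Y` are projective). -/
def IsConflation (S : ShortComplex (BoundedProjComplex A a b)) : Prop :=
  (S.map (IsBoundedProj A a b).ι).ShortExact

/-- Injective objects of the exact category `C_[a,b](proj A)`. -/
def IsInjectiveComplex (I : BoundedProjComplex A a b) : Prop :=
  ∀ S : ShortComplex (BoundedProjComplex A a b), IsConflation S →
    ∀ g : S.X₁ ⟶ I, ∃ h : S.X₂ ⟶ I, S.f ≫ h = g

/-- Almost split sequences of the exact category `C_[a,b](proj A)`. -/
structure IsAlmostSplitSequence (S : ShortComplex (BoundedProjComplex A a b)) : Prop where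
  conflation : IsConflation S
  left : IsLeftAlmostSplit S.f
  right : IsRightAlmostSplit S.g

/-- `Y` is `τ⁻¹ X`, the inverse Auslander–Reiten translate of `X` in `C_[a,b](proj A)`: it is the
last term of an almost split sequence `0 ⟶ X ⟶ E ⟶ Y ⟶ 0`. -/
def IsInverseTranslate (X Y : BoundedProjComplex A a b) : Prop :=
  ∃ (E : BoundedProjComplex A a b) (f : X ⟶ E) (g : E ⟶ Y) (hfg : f ≫ g = 0),
    IsAlmostSplitSequence (ShortComplex.mk f g hfg)

end Exact

/-! ### Socles, projective covers, `add` -/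

section Modules

variable {A : Type u} [Ring A]

/-- The socle of a module: the sum of its simple submodules. -/
def moduleSocle (A : Type u) [Ring A] (M : Type u) [AddCommGroup M] [Module A M] :
    Submodule A M :=
  sSup {N : Submodule A M | IsSimpleModule A N}

/-- `p : P → M` is a projective cover: `P` is projective, `p` is surjective and its kernel is
superfluous. -/
structure IsProjectiveCover {P M : ModuleCat.{u} A} (p : P ⟶ M) : Prop where
  projective : Module.Projective A P
  surjective : Function.Surjective p
  superfluous : ∀ N : Submodule A P, N ⊔ LinearMap.ker p.hom = ⊤ → N = ⊤

/-- `Q` is isomorphic to a direct summand of `P`. -/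
def IsDirectSummand (Q P : ModuleCat.{u} A) : Prop := Nonempty (Retract Q P)

/-- `M` is in `add P`: it is isomorphic to a finite direct sum of direct summands of `P`. -/
def InAdd (P M : ModuleCat.{u} A) : Prop :=
  ∃ (k : ℕ) (Q : Fin k → ModuleCat.{u} A),
    (∀ j, IsDirectSummand (Q j) P) ∧ Nonempty (M ≅ ⨁ Q)

end Modules

/-- The module `soc (Ker d_X^1)`, where `d_X^1 : X^1 ⟶ X^2`. -/
abbrev socKerOne {A : Type u} [Ring A] {a b : ℤ} (X : BoundedProjComplex A a b) :
    ModuleCat.{u} A :=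
  ModuleCat.of A (moduleSocle A (LinearMap.ker (X.obj.d 1 2).hom))

/-!
Put `K = Ker d_X¹`. Since `P ⟶ soc K` is a projective cover, an indecomposable projective module `Q`
is a summand of `P` if and only if some map `Q ⟶ K` has a simple image. So it suffices to produce
maps with simple image, and these come from testing a left almost split morphism `f : X ⟶ Z` on
complexes `⋯ ⟶ 0 ⟶ V ⟶ C¹ ⟶ C² ⟶ ⋯`. Throughout, `X⁰ = 0` makes a chain map `Z ⟶ X` the same thing
as one in positive degrees that is annihilated by `Z⁰ ⟶ Z¹`.

* If `q : Q ⟶ K` has a simple image `S`, then `X` is not a summand of `Q ⟶ X¹ ⟶ X² ⟶ ⋯`, so the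
  inclusion of `X` factors through `f`. The factorization gives a map `Z⁰ ⟶ Q` with nonzero
  composite to `S`, as `f` would be a section otherwise. Hence `Q` and `Z⁰` both map onto `S`, and
  Fitting's lemma makes `Q` a summand of `Z⁰`.
* In an almost split sequence `0 ⟶ X ⟶ E ⟶ Y ⟶ 0` the map `f : X ⟶ E` is left minimal, and
  `E⁰ ≅ Y⁰`. For a proper submodule `N` of `E⁰` and a map `V ⟶ E⁰` with image `N`, the morphism
  from `X` to `V ⟶ E¹ ⟶ E² ⟶ ⋯` cannot factor through `f`: composed with the map back to `E` this
  would be an automorphism of `E` whose degree `0` part lands in `N`. So it is a section, and its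
  retraction gives a nonzero map `E⁰ ⟶ K` that vanishes on `N`. Taking for `N` the preimage of a
  maximal submodule of an indecomposable summand `Q` of `E⁰`, its restriction to `Q` has a simple
  image.
-/

section IndecomposableModules

variable {A : Type u} [Ring A]

theorem indecomposable_iff_isCompl {M : ModuleCat.{v} A} :
    Indecomposable M ↔
      Nontrivial M ∧ ∀ N L : Submodule A M, IsCompl N L → N = ⊥ ∨ L = ⊥ := by
  have isZero_iff (N : ModuleCat.{v} A) : IsZero N ↔ Subsingleton N :=
    ⟨ModuleCat.subsingleton_of_isZero, fun _ => ModuleCat.isZero_of_subsingleton N⟩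
  simp only [Indecomposable, isZero_iff, not_subsingleton_iff_nontrivial]
  refine and_congr_right fun _ => ⟨fun h N L hNL => ?_, fun h M₁ M₂ e => ?_⟩
  · let e : M ≅ ModuleCat.of A N ⊞ ModuleCat.of A L :=
      (Submodule.prodEquivOfIsCompl N L hNL).symm.toModuleIso ≪≫
        (ModuleCat.biprodIsoProd (ModuleCat.of A N) (ModuleCat.of A L)).symm
    exact (h _ _ e).imp Submodule.subsingleton_iff_eq_bot.1 Submodule.subsingleton_iff_eq_bot.1
  · let e' : (M₁ × M₂) ≃ₗ[A] M := (e ≪≫ ModuleCat.biprodIsoProd M₁ M₂).toLinearEquiv.symm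
    have hcompl := (Submodule.orderIsoMapComap e').isCompl
      (LinearMap.isCompl_range_inl_inr (R := A) (M := M₁) (M₂ := M₂))
    have subsingleton_of_range {L : Type v} [AddCommGroup L] [Module A L] {f : L →ₗ[A] M₁ × M₂}
        (hf : Function.Injective f)
        (hrange : Submodule.orderIsoMapComap e' (LinearMap.range f) = ⊥) : Subsingleton L :=
      (LinearEquiv.ofInjective f hf).toEquiv.subsingleton_congr.2
        (Submodule.subsingleton_iff_eq_bot.2 ((map_eq_bot_iff _).1 hrange))
    exact (h _ _ hcompl).imp (subsingleton_of_range LinearMap.inl_injective)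
      (subsingleton_of_range LinearMap.inr_injective)

theorem bijective_or_isNilpotent_of_indecomposable {Q : ModuleCat.{v} A} (hQ : Indecomposable Q)
    [IsNoetherian A Q] [IsArtinian A Q] (e : Module.End A Q) :
    Function.Bijective e ∨ IsNilpotent e := by
  obtain ⟨k, hcompl, hk⟩ := (e.eventually_isCompl_ker_pow_range_pow.and
    (Filter.eventually_ne_atTop 0)).exists
  refine ((indecomposable_iff_isCompl.1 hQ).2 _ _ hcompl).imp (fun hker => ?_) fun hrange =>
    ⟨k, LinearMap.range_eq_bot.1 hrange⟩
  exact IsArtinian.bijective_of_injective_endomorphism e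
    (Module.End.injective_of_iterate_injective hk (LinearMap.ker_eq_bot.1 hker))

theorem isDirectSummand_of_ne_zero_of_isSimpleModule {Q P : ModuleCat.{u} A}
    (hQ : Indecomposable Q) [IsNoetherian A Q] [IsArtinian A Q] [Module.Projective A Q]
    [Module.Projective A P] {S : Type*} [AddCommGroup S] [Module A S] [IsSimpleModule A S]
    {π : Q →ₗ[A] S} (hπ : π ≠ 0) {ρ : P →ₗ[A] S} (hρ : ρ ≠ 0) : IsDirectSummand Q P := by
  obtain ⟨i, hi⟩ := Module.projective_lifting_property ρ π (ρ.surjective_of_ne_zero hρ)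
  obtain ⟨r, hr⟩ := Module.projective_lifting_property π ρ (π.surjective_of_ne_zero hπ)
  have hpow (k : ℕ) : π ∘ₗ ((r ∘ₗ i) ^ k : Module.End A Q) = π := by
    induction k with
    | zero => rfl
    | succ k ih =>
      rw [pow_succ, Module.End.mul_eq_comp, ← LinearMap.comp_assoc, ih, ← LinearMap.comp_assoc,
        hr, hi]
  obtain hbij | ⟨k, hk⟩ := bijective_or_isNilpotent_of_indecomposable hQ (r ∘ₗ i)
  · let e := LinearEquiv.ofBijective (r ∘ₗ i) hbij
    exact ⟨⟨ModuleCat.ofHom (i ∘ₗ e.symm.toLinearMap), ModuleCat.ofHom r,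
      ModuleCat.hom_ext (LinearMap.ext e.apply_symm_apply)⟩⟩
  · exact absurd (by rw [← hpow k, hk, LinearMap.comp_zero]) hπ

theorem exists_linearEquiv_pi_indecomposable (M : Type v) [AddCommGroup M] [Module A M]
    [IsArtinian A M] :
    ∃ (J : Type) (_ : Finite J) (Q : J → ModuleCat.{v} A),
      (∀ j, Indecomposable (Q j)) ∧ Nonempty (M ≃ₗ[A] ∀ j, Q j) := by
  suffices ∀ N : Submodule A M, ∃ (J : Type) (_ : Finite J) (Q : J → ModuleCat.{v} A),
      (∀ j, Indecomposable (Q j)) ∧ Nonempty (N ≃ₗ[A] ∀ j, Q j) by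
    obtain ⟨J, hJ, Q, hQ, ⟨e⟩⟩ := this ⊤
    exact ⟨J, hJ, Q, hQ, ⟨Submodule.topEquiv.symm ≪≫ₗ e⟩⟩
  intro N
  induction N using IsArtinian.induction with
  | hgt N ih =>
  rcases subsingleton_or_nontrivial N with hN | hN
  · exact ⟨Empty, inferInstance, nofun, nofun, ⟨LinearEquiv.ofSubsingleton _ _⟩⟩
  by_cases hind : Indecomposable (ModuleCat.of A N)
  · exact ⟨Unit, inferInstance, fun _ => ModuleCat.of A N, fun _ => hind,
      ⟨(LinearEquiv.funUnique Unit A N).symm⟩⟩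
  obtain ⟨L₁, L₂, hL, hL₁, hL₂⟩ : ∃ L₁ L₂ : Submodule A N, IsCompl L₁ L₂ ∧ L₁ ≠ ⊥ ∧ L₂ ≠ ⊥ := by
    by_contra! h
    exact hind (indecomposable_iff_isCompl.2
      ⟨hN, fun L₁ L₂ hL => or_iff_not_imp_left.2 (h L₁ L₂ hL)⟩)
  have map_lt {L : Submodule A N} (hL : L ≠ ⊤) : L.map N.subtype < N := by
    simpa using Submodule.map_strictMono_of_injective N.injective_subtype hL.lt_top
  obtain ⟨J₁, _, Q₁, hQ₁, ⟨e₁⟩⟩ := ih _ (map_lt fun h => hL₂ (eq_bot_of_top_isCompl (h ▸ hL)))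
  obtain ⟨J₂, _, Q₂, hQ₂, ⟨e₂⟩⟩ := ih _ (map_lt fun h => hL₁ (eq_bot_of_isCompl_top (h ▸ hL)))
  refine ⟨J₁ ⊕ J₂, inferInstance, Sum.elim Q₁ Q₂, Sum.rec hQ₁ hQ₂,
    ⟨(Submodule.prodEquivOfIsCompl L₁ L₂ hL).symm ≪≫ₗ
      LinearEquiv.prodCongr (N.equivSubtypeMap L₁ ≪≫ₗ e₁) (N.equivSubtypeMap L₂ ≪≫ₗ e₂) ≪≫ₗ
      (LinearEquiv.sumPiEquivProdPi A J₁ J₂ fun j => (Sum.elim Q₁ Q₂ j : ModuleCat.{v} A)).symm⟩⟩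

end IndecomposableModules

section DirectSummands

variable {A : Type u} [Ring A]

theorem IsDirectSummand.finite {Q P : ModuleCat.{u} A} (h : IsDirectSummand Q P)
    [Module.Finite A P] : Module.Finite A Q := by
  obtain ⟨t⟩ := h
  exact Module.Finite.of_surjective t.r.hom fun x => ⟨t.i x, congr($(t.retract) x)⟩

theorem IsDirectSummand.projective {Q P : ModuleCat.{u} A} (h : IsDirectSummand Q P)
    [Module.Projective A P] : Module.Projective A Q := by
  obtain ⟨t⟩ := h
  exact Module.Projective.of_split t.i.hom t.r.hom congr(($(t.retract)).hom)

theorem InAdd.of_iso {P M N : ModuleCat.{u} A} (h : InAdd P M) (e : M ≅ N) : InAdd P N := by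
  obtain ⟨k, Q, hQ, ⟨e'⟩⟩ := h
  exact ⟨k, Q, hQ, ⟨e.symm ≪≫ e'⟩⟩

theorem InAdd.of_forall_indecomposable {P M : ModuleCat.{u} A} [IsArtinian A M]
    (h : ∀ Q : ModuleCat.{u} A, Indecomposable Q → IsDirectSummand Q M → IsDirectSummand Q P) :
    InAdd P M := by
  obtain ⟨J, _, Q, hQ, ⟨e⟩⟩ := exists_linearEquiv_pi_indecomposable (A := A) M
  obtain ⟨k, ⟨σ⟩⟩ := Finite.exists_equiv_fin J
  obtain ⟨e'⟩ : Nonempty (M ≅ ⨁ fun j => Q (σ.symm j)) :=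
    ⟨(e ≪≫ₗ (LinearEquiv.piCongrLeft A (fun j => Q j) σ.symm).symm).toModuleIso ≪≫
      (ModuleCat.biproductIsoPi _).symm⟩
  let t (j : Fin k) : Retract (Q (σ.symm j)) M :=
    { i := biproduct.ι (fun j => Q (σ.symm j)) j ≫ e'.inv
      r := e'.hom ≫ biproduct.π (fun j => Q (σ.symm j)) j }
  exact ⟨k, _, fun j => h _ (hQ _) ⟨t j⟩, ⟨e'⟩⟩

end DirectSummands

section ProjectiveCoverOfSocle

variable {A : Type u} [Ring A]

instance isSemisimpleModule_moduleSocle (M : Type u) [AddCommGroup M] [Module A M] :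
    IsSemisimpleModule A (moduleSocle A M) := by
  rw [moduleSocle, sSup_eq_iSup]
  exact isSemisimpleModule_biSup_of_isSemisimpleModule_submodule (p := fun N => N)
    fun N (hN : IsSimpleModule A N) => inferInstance

theorem exists_isSimpleModule_comp_ne_zero {M N : Type*} [AddCommGroup M] [Module A M]
    [AddCommGroup N] [Module A N] [IsSemisimpleModule A N] {ψ : M →ₗ[A] N} (hψ : ψ ≠ 0) :
    ∃ S : Submodule A N, IsSimpleModule A S ∧ ∃ π : N →ₗ[A] S, π ∘ₗ ψ ≠ 0 := by
  obtain ⟨S, hS, hsimple⟩ :=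
    (IsSemisimpleModule.eq_bot_or_exists_simple_le (LinearMap.range ψ)).resolve_left
      fun h => hψ (LinearMap.range_eq_bot.1 h)
  obtain ⟨π, hπ⟩ :=
    IsSemisimpleModule.extension_property S.subtype S.injective_subtype LinearMap.id
  refine ⟨S, hsimple, π, fun h => ?_⟩
  have := IsSimpleModule.nontrivial A S
  obtain ⟨s, hs⟩ := exists_ne (0 : S)
  obtain ⟨x, hx⟩ := hS s.2
  exact hs (calc
    s = π s := (LinearMap.congr_fun hπ s).symm
    _ = π (ψ x) := by rw [hx]
    _ = 0 := LinearMap.congr_fun h x)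

theorem IsProjectiveCover.finite {P M : ModuleCat.{u} A} {p : P ⟶ M} (hp : IsProjectiveCover p)
    [Module.Finite A M] : Module.Finite A P := by
  obtain ⟨k, f, hf⟩ := Module.Finite.exists_fin' A M
  obtain ⟨g, hg⟩ := Module.projective_lifting_property p.hom f hp.surjective
  have hsup : LinearMap.range g ⊔ LinearMap.ker p.hom = ⊤ := by
    rw [← Submodule.comap_map_eq, ← LinearMap.range_comp, hg, LinearMap.range_eq_top.2 hf,
      Submodule.comap_top]
  exact Module.Finite.of_surjective g (LinearMap.range_eq_top.1 (hp.superfluous _ hsup))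

theorem IsProjectiveCover.comp_ne_zero {P M Q : ModuleCat.{u} A} {p : P ⟶ M}
    (hp : IsProjectiveCover p) (t : Retract Q P) (hQ : ¬ IsZero Q) : t.i ≫ p ≠ 0 := by
  intro h
  have hsup : LinearMap.ker t.r.hom ⊔ LinearMap.ker p.hom = ⊤ := by
    refine eq_top_iff.2 fun x _ => Submodule.mem_sup.2
      ⟨x - t.i (t.r x), ?_, t.i (t.r x), congr($h (t.r x)), sub_add_cancel _ _⟩
    exact (map_sub t.r.hom _ _).trans (sub_eq_zero.2 congr($(t.retract) (t.r x)).symm)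
  have hr : t.r = 0 := ModuleCat.hom_ext (LinearMap.ker_eq_top.1 (hp.superfluous _ hsup))
  exact hQ ((IsZero.iff_id_eq_zero Q).2 (by rw [← t.retract, hr, comp_zero]))

theorem IsProjectiveCover.isDirectSummand_iff {P Q : ModuleCat.{u} A} {K : Type u}
    [AddCommGroup K] [Module A K] {p : P ⟶ ModuleCat.of A (moduleSocle A K)}
    (hp : IsProjectiveCover p) (hQ : Indecomposable Q) [IsNoetherian A Q] [IsArtinian A Q]
    [Module.Projective A Q] :
    IsDirectSummand Q P ↔ ∃ q : Q →ₗ[A] K, IsSimpleModule A (LinearMap.range q) := by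
  constructor
  · rintro ⟨t⟩
    obtain ⟨S, _, π, hπ⟩ := exists_isSimpleModule_comp_ne_zero (A := A) (ψ := (t.i ≫ p).hom)
      fun h => hp.comp_ne_zero t hQ.1 (ModuleCat.hom_ext h)
    let ι : S →ₗ[A] K := (moduleSocle A K).subtype ∘ₗ S.subtype
    have hι : Function.Injective ι :=
      (moduleSocle A K).injective_subtype.comp S.injective_subtype
    refine ⟨ι ∘ₗ π ∘ₗ (t.i ≫ p).hom, ?_⟩
    rw [LinearMap.range_comp_of_range_eq_top _
      (LinearMap.range_eq_top.2 (LinearMap.surjective_of_ne_zero hπ))]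
    exact IsSimpleModule.congr (LinearEquiv.ofInjective ι hι).symm
  · rintro ⟨q, hq⟩
    have := hp.projective
    have := IsSimpleModule.nontrivial A (LinearMap.range q)
    obtain ⟨σ, hσ⟩ := IsSemisimpleModule.extension_property
      (Submodule.inclusion (show LinearMap.range q ≤ moduleSocle A K from le_sSup hq))
      (Submodule.inclusion_injective _) LinearMap.id
    have hσp : Function.Surjective (σ ∘ₗ p.hom) :=
      (LinearMap.surjective_of_comp_eq_id _ _ hσ).comp hp.surjective
    exact isDirectSummand_of_ne_zero_of_isSimpleModule hQ
      (LinearMap.ne_zero_of_surjective q.surjective_rangeRestrict)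
      (LinearMap.ne_zero_of_surjective hσp)

end ProjectiveCoverOfSocle

section TruncationAndAugmentation

variable {V : Type u} [Category.{v} V] [HasZeroMorphisms V]

/-- The chain map with prescribed components in degrees `≥ 0` from a complex that vanishes in
negative degrees. -/
def homOfNat {D E : CochainComplex V ℤ} (hD : ∀ m : ℕ, IsZero (D.X (.negSucc m)))
    (α₀ : D.X 0 ⟶ E.X 0) (α : ∀ m : ℕ, D.X (.ofNat (m + 1)) ⟶ E.X (.ofNat (m + 1)))
    (h₀ : α₀ ≫ E.d 0 1 = D.d 0 1 ≫ α 0)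
    (h : ∀ m, α m ≫ E.d (.ofNat (m + 1)) (.ofNat (m + 1 + 1)) =
      D.d (.ofNat (m + 1)) (.ofNat (m + 1 + 1)) ≫ α (m + 1)) : D ⟶ E :=
  CochainComplex.ofHom
    (fun i => match i with
      | .ofNat 0 => α₀
      | .ofNat (m + 1) => α m
      | .negSucc _ => 0)
    (fun i => match i with
      | .ofNat 0 => h₀
      | .ofNat (m + 1) => h m
      | .negSucc m => (hD m).eq_of_src _ _)

theorem hom_ext_of_nat {D E : CochainComplex V ℤ} (hD : ∀ m : ℕ, IsZero (D.X (.negSucc m)))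
    {f g : D ⟶ E} (h₀ : f.f 0 = g.f 0)
    (h : ∀ m : ℕ, f.f (.ofNat (m + 1)) = g.f (.ofNat (m + 1))) : f = g := by
  ext1 i
  match i with
  | .ofNat 0 => exact h₀
  | .ofNat (m + 1) => exact h m
  | .negSucc m => exact (hD m).eq_of_src _ _

variable [HasZeroObject V] (C : CochainComplex V ℤ) (Q : V)

open ZeroObject in
/-- The terms of `truncAugment`. -/
noncomputable def truncAugmentX : ℤ → V
  | .ofNat 0 => Q
  | .ofNat (m + 1) => C.X (.ofNat (m + 1))
  | .negSucc _ => 0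

variable {Q} (q : Q ⟶ C.X 1)

/-- The differentials of `truncAugment`. -/
noncomputable def truncAugmentD : ∀ i : ℤ, truncAugmentX C Q i ⟶ truncAugmentX C Q (i + 1)
  | .ofNat 0 => q
  | .ofNat (m + 1) => C.d (.ofNat (m + 1)) (.ofNat (m + 1 + 1))
  | .negSucc _ => 0

/-- The complex `⋯ ⟶ 0 ⟶ Q ⟶ C¹ ⟶ C² ⟶ ⋯` with `Q` in degree `0`: the brutal truncation of `C`
in degrees `≥ 1`, augmented by `q : Q ⟶ C¹`. -/
noncomputable def truncAugment (hq : q ≫ C.d 1 2 = 0) : CochainComplex V ℤ :=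
  CochainComplex.of (truncAugmentX C Q) (truncAugmentD C q) fun i => match i with
    | .ofNat 0 => hq
    | .ofNat (m + 1) => C.d_comp_d (.ofNat (m + 1)) (.ofNat (m + 1 + 1)) (.ofNat (m + 1 + 1 + 1))
    | .negSucc _ => zero_comp

variable {q} (hq : q ≫ C.d 1 2 = 0)

theorem truncAugment_d_zero : (truncAugment C q hq).d 0 1 = q :=
  CochainComplex.of_d (truncAugmentX C Q) (truncAugmentD C q) 0

theorem truncAugment_d_succ (m : ℕ) :
    (truncAugment C q hq).d (.ofNat (m + 1)) (.ofNat (m + 1 + 1)) =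
      C.d (.ofNat (m + 1)) (.ofNat (m + 1 + 1)) :=
  CochainComplex.of_d (truncAugmentX C Q) (truncAugmentD C q) (.ofNat (m + 1))

variable {C} {D : CochainComplex V ℤ}

theorem truncAugment_f_zero_comp (g : D ⟶ truncAugment C q hq) :
    g.f 0 ≫ q = D.d 0 1 ≫ (g.f 1 : D.X 1 ⟶ C.X 1) :=
  congr(g.f 0 ≫ $(truncAugment_d_zero C hq)).symm.trans (g.comm 0 1)

theorem truncAugment_f_succ_comp (g : D ⟶ truncAugment C q hq) (m : ℕ) :
    g.f (.ofNat (m + 1)) ≫ C.d (.ofNat (m + 1)) (.ofNat (m + 1 + 1)) =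
      D.d (.ofNat (m + 1)) (.ofNat (m + 1 + 1)) ≫ g.f (.ofNat (m + 1 + 1)) :=
  congr(g.f (.ofNat (m + 1)) ≫ $(truncAugment_d_succ C hq m)).symm.trans (g.comm _ _)

theorem truncAugment_comp_f_one_eq_zero (hD : IsZero (D.X 0)) (g : truncAugment C q hq ⟶ D) :
    q ≫ g.f 1 = 0 := by
  have hcomm : (truncAugment C q hq).d 0 1 ≫ g.f 1 = 0 := by
    rw [← g.comm, hD.eq_of_tgt (g.f 0) 0, zero_comp]
  exact congr($(truncAugment_d_zero C hq) ≫ g.f 1).symm.trans hcomm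

theorem truncAugment_comp_f_succ (g : truncAugment C q hq ⟶ D) (m : ℕ) :
    C.d (.ofNat (m + 1)) (.ofNat (m + 1 + 1)) ≫ g.f (.ofNat (m + 1 + 1)) =
      (g.f (.ofNat (m + 1)) : C.X (.ofNat (m + 1)) ⟶ D.X _) ≫
        D.d (.ofNat (m + 1)) (.ofNat (m + 1 + 1)) :=
  congr($(truncAugment_d_succ C hq m) ≫ g.f (.ofNat (m + 1 + 1))).symm.trans (g.comm _ _).symm

/-- A chain map `g : D ⟶ C` and a map `α : D⁰ ⟶ Q` that agree in `C¹` combine to a chain map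
into `truncAugment C q hq`. -/
noncomputable def truncAugmentLift (hD : ∀ m : ℕ, IsZero (D.X (.negSucc m))) (g : D ⟶ C)
    (α : D.X 0 ⟶ Q) (hα : α ≫ q = D.d 0 1 ≫ g.f 1) : D ⟶ truncAugment C q hq :=
  homOfNat hD α (fun m => g.f (.ofNat (m + 1))) ((truncAugment_d_zero C hq).symm ▸ hα)
    fun m => (truncAugment_d_succ C hq m).symm ▸ g.comm (.ofNat (m + 1)) (.ofNat (m + 1 + 1))

/-- A chain map `g : C ⟶ D` and a map `β : Q ⟶ D⁰` that agree in `D¹` combine to a chain map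
out of `truncAugment C q hq`. -/
noncomputable def truncAugmentDesc (g : C ⟶ D) (β : Q ⟶ D.X 0)
    (hβ : β ≫ D.d 0 1 = q ≫ g.f 1) : truncAugment C q hq ⟶ D :=
  homOfNat (fun _ => isZero_zero V) β (fun m => g.f (.ofNat (m + 1)))
    ((truncAugment_d_zero C hq).symm ▸ hβ)
    fun m => (truncAugment_d_succ C hq m).symm ▸ g.comm (.ofNat (m + 1)) (.ofNat (m + 1 + 1))

end TruncationAndAugmentation

section LeftMinimal

variable {C : Type v} [Category.{w} C]

/-- `f` is left minimal: the only endomorphisms `e` of its target with `f ≫ e = f` are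
isomorphisms. -/
def IsLeftMinimal {X Z : C} (f : X ⟶ Z) : Prop :=
  ∀ e : Z ⟶ Z, f ≫ e = f → IsIso e

variable [Preadditive C]

theorem isIso_id_sub_comp_comm {E Y : C} (g : E ⟶ Y) (t : Y ⟶ E) [IsIso (𝟙 Y - t ≫ g)] :
    IsIso (𝟙 E - g ≫ t) := by
  have hv : (𝟙 Y - t ≫ g) ≫ inv (𝟙 Y - t ≫ g) = 𝟙 Y := IsIso.hom_inv_id _
  have hv' : inv (𝟙 Y - t ≫ g) ≫ (𝟙 Y - t ≫ g) = 𝟙 Y := IsIso.inv_hom_id _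
  set v := inv (𝟙 Y - t ≫ g)
  refine ⟨𝟙 E + g ≫ v ≫ t, ?_, ?_⟩
  · calc (𝟙 E - g ≫ t) ≫ (𝟙 E + g ≫ v ≫ t)
      _ = 𝟙 E - g ≫ t + g ≫ ((𝟙 Y - t ≫ g) ≫ v) ≫ t := by
        simp only [Preadditive.sub_comp, Preadditive.comp_add, Preadditive.comp_sub,
          Category.id_comp, Category.comp_id, Category.assoc]
      _ = 𝟙 E := by rw [hv, Category.id_comp, sub_add_cancel]
  · calc (𝟙 E + g ≫ v ≫ t) ≫ (𝟙 E - g ≫ t)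
      _ = 𝟙 E - g ≫ t + g ≫ (v ≫ (𝟙 Y - t ≫ g)) ≫ t := by
        simp only [Preadditive.sub_comp, Preadditive.add_comp, Preadditive.comp_sub,
          Category.id_comp, Category.comp_id, Category.assoc]
        abel
      _ = 𝟙 E := by rw [hv', Category.id_comp, sub_add_cancel]

theorem IsRightAlmostSplit.isIso_id_sub_comp {E Y : C} {g : E ⟶ Y} (hg : IsRightAlmostSplit g)
    (t : Y ⟶ E) : IsIso (𝟙 Y - t ≫ g) := by
  -- `𝟙 = t ≫ g + (𝟙 - t ≫ g)`, and two maps that factor through `g` cannot add up to `𝟙`.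
  have isSplitEpi_id_sub (t : Y ⟶ E) : IsSplitEpi (𝟙 Y - t ≫ g) := by
    by_contra h
    obtain ⟨l, hl⟩ := hg.2 _ h
    exact hg.1 ⟨⟨l + t, by rw [Preadditive.add_comp, hl, sub_add_cancel]⟩⟩
  obtain ⟨⟨s, hs⟩⟩ := isSplitEpi_id_sub t
  have hs' : s = 𝟙 Y - (-(s ≫ t)) ≫ g := by
    simp only [Preadditive.comp_sub, Category.comp_id] at hs
    simp only [Preadditive.neg_comp, Category.assoc, sub_neg_eq_add, ← hs, sub_add_cancel]
  obtain ⟨⟨s', hs''⟩⟩ : IsSplitEpi s := hs' ▸ isSplitEpi_id_sub _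
  have : IsIso s := by
    have : IsSplitMono s := ⟨⟨_, hs⟩⟩
    have : IsSplitEpi s := ⟨⟨s', hs''⟩⟩
    exact isIso_of_mono_of_isSplitEpi s
  exact IsIso.of_isIso_fac_left hs

end LeftMinimal

section Complexes

variable {A : Type u} [Ring A]

theorem isBoundedProj_truncAugment {b : ℤ} (hb : 0 ≤ b) {C : CochainComplex (ModuleCat.{u} A) ℤ}
    (hC : IsBoundedProj A 0 b C) {Q : ModuleCat.{u} A} [Module.Finite A Q] [Module.Projective A Q]
    {q : Q ⟶ C.X 1} (hq : q ≫ C.d 1 2 = 0) : IsBoundedProj A 0 b (truncAugment C q hq) := by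
  refine ⟨fun i => ?_, fun i hi => ?_⟩
  · match i with
    | .ofNat 0 => exact ⟨‹Module.Finite A Q›, ‹Module.Projective A Q›⟩
    | .ofNat (m + 1) => exact hC.1 (.ofNat (m + 1))
    | .negSucc m =>
      have : Subsingleton ((truncAugment C q hq).X (.negSucc m)) :=
        ModuleCat.subsingleton_of_isZero (isZero_zero _)
      exact ⟨inferInstance, inferInstance⟩
  · match i with
    | .ofNat 0 => exact absurd ⟨le_rfl, hb⟩ hi
    | .ofNat (m + 1) => exact hC.2 (.ofNat (m + 1)) hi
    | .negSucc _ => exact isZero_zero _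

theorem IsBoundedProj.isZero_negSucc {b : ℤ} {D : CochainComplex (ModuleCat.{u} A) ℤ}
    (hD : IsBoundedProj A 0 b D) (m : ℕ) : IsZero (D.X (.negSucc m)) :=
  hD.2 _ fun h => absurd h.1 (by lia)

theorem isZero_X_zero {b : ℤ} (X : BoundedProjComplex A 1 b) : IsZero (X.obj.X 0) :=
  X.property.2 0 fun h => absurd h.1 (by lia)

theorem isSplitMono_of_retraction {b : ℤ} {X Z : BoundedProjComplex A 0 b}
    (hX : IsZero (X.obj.X 0)) (f : X ⟶ Z)
    (ρ : ∀ m : ℕ, Z.obj.X (.ofNat (m + 1)) ⟶ X.obj.X (.ofNat (m + 1)))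
    (hρ : ∀ m, ρ m ≫ X.obj.d (.ofNat (m + 1)) (.ofNat (m + 1 + 1)) =
      Z.obj.d (.ofNat (m + 1)) (.ofNat (m + 1 + 1)) ≫ ρ (m + 1))
    (hfρ : ∀ m, f.hom.f (.ofNat (m + 1)) ≫ ρ m = 𝟙 _) (h₀ : Z.obj.d 0 1 ≫ ρ 0 = 0) :
    IsSplitMono f := by
  let r : Z.obj ⟶ X.obj :=
    homOfNat Z.property.isZero_negSucc 0 ρ (by rw [h₀, zero_comp]) hρ
  have hr : f.hom ≫ r = 𝟙 X.obj :=
    hom_ext_of_nat X.property.isZero_negSucc (hX.eq_of_src _ _) hfρ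
  exact ⟨⟨ObjectProperty.homMk r, ObjectProperty.hom_ext _ hr⟩⟩

/-- The test morphism is the one from `X` to `⋯ ⟶ 0 ⟶ Q ⟶ X¹ ⟶ X² ⟶ ⋯` that is the identity in
positive degrees: a retraction of it would force `q = 0`. -/
theorem IsLeftAlmostSplit.exists_comp_ne_zero {n : ℕ} {X Z : BoundedProjComplex A 0 n}
    (hX : IsZero (X.obj.X 0)) {f : X ⟶ Z} (hf : IsLeftAlmostSplit f)
    {Q : ModuleCat.{u} A} [Module.Finite A Q] [Module.Projective A Q] {q : Q ⟶ X.obj.X 1}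
    (hq : q ≫ X.obj.d 1 2 = 0) (hq₀ : q ≠ 0) : ∃ h : Z.obj.X 0 ⟶ Q, h ≫ q ≠ 0 := by
  let W : BoundedProjComplex A 0 n :=
    ⟨truncAugment X.obj q hq, isBoundedProj_truncAugment (Int.natCast_nonneg n) X.property hq⟩
  let c : X ⟶ W := ObjectProperty.homMk
    (truncAugmentLift hq X.property.isZero_negSucc (𝟙 X.obj) 0 (hX.eq_of_src _ _))
  have hc : ¬ IsSplitMono c := by
    rintro ⟨⟨r, hr⟩⟩
    let r₁ : X.obj.X 1 ⟶ X.obj.X 1 := r.hom.f 1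
    have hr₁ : r₁ = 𝟙 (X.obj.X 1) := (Category.id_comp r₁).symm.trans congr(($hr).hom.f 1)
    have hqr : q ≫ r₁ = 0 := truncAugment_comp_f_one_eq_zero hq hX r.hom
    exact hq₀ (by rwa [hr₁, Category.comp_id] at hqr)
  obtain ⟨h, hh⟩ := hf.2 c hc
  exact ⟨h.hom.f 0, fun h₀ => hf.1 <| isSplitMono_of_retraction hX f
    (fun m => h.hom.f (.ofNat (m + 1))) (truncAugment_f_succ_comp hq h.hom)
    (fun m => congr(($hh).hom.f (.ofNat (m + 1)))) <|
    (truncAugment_f_zero_comp hq h.hom).symm.trans h₀⟩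

/-- The test morphism is the one from `X` to `⋯ ⟶ 0 ⟶ V ⟶ Z¹ ⟶ Z² ⟶ ⋯` given by `f` in positive
degrees: a retraction of it yields `φ`, and a factorization of it through `f` yields `e`. -/
theorem IsLeftAlmostSplit.exists_ne_zero_or_factors {n : ℕ} {X Z : BoundedProjComplex A 0 n}
    (hX : IsZero (X.obj.X 0)) {f : X ⟶ Z} (hf : IsLeftAlmostSplit f)
    {V : ModuleCat.{u} A} [Module.Finite A V] [Module.Projective A V] (ν : V ⟶ Z.obj.X 0) :
    (∃ φ : Z.obj.X 0 ⟶ X.obj.X 1, φ ≠ 0 ∧ ν ≫ φ = 0 ∧ φ ≫ X.obj.d 1 2 = 0) ∨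
      ∃ (e : Z ⟶ Z) (l : Z.obj.X 0 ⟶ V), f ≫ e = f ∧ l ≫ ν = e.hom.f 0 := by
  have hd : (ν ≫ Z.obj.d 0 1) ≫ Z.obj.d 1 2 = 0 := by simp
  let W : BoundedProjComplex A 0 n :=
    ⟨truncAugment Z.obj _ hd, isBoundedProj_truncAugment (Int.natCast_nonneg n) Z.property hd⟩
  let f' : X ⟶ W := ObjectProperty.homMk
    (truncAugmentLift hd X.property.isZero_negSucc f.hom 0 (hX.eq_of_src _ _))
  let c : W ⟶ Z :=
    ObjectProperty.homMk (truncAugmentDesc hd (𝟙 Z.obj) ν (Category.comp_id _).symm)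
  have hf'c : f' ≫ c = f := ObjectProperty.hom_ext _ <|
    hom_ext_of_nat X.property.isZero_negSucc (hX.eq_of_src _ _) fun m =>
      Category.comp_id (f.hom.f (.ofNat (m + 1)))
  by_cases hf' : IsSplitMono f'
  · left
    obtain ⟨⟨r, hr⟩⟩ := hf'
    let ρ (m : ℕ) : Z.obj.X (.ofNat (m + 1)) ⟶ X.obj.X (.ofNat (m + 1)) :=
      r.hom.f (.ofNat (m + 1))
    have hρ (m : ℕ) : ρ m ≫ X.obj.d (.ofNat (m + 1)) (.ofNat (m + 1 + 1)) =
        Z.obj.d (.ofNat (m + 1)) (.ofNat (m + 1 + 1)) ≫ ρ (m + 1) :=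
      (truncAugment_comp_f_succ hd r.hom m).symm
    have hνρ : (ν ≫ Z.obj.d 0 1) ≫ ρ 0 = 0 := truncAugment_comp_f_one_eq_zero hd hX r.hom
    refine ⟨Z.obj.d 0 1 ≫ ρ 0, fun h₀ => hf.1 ?_, (Category.assoc _ _ _).symm.trans hνρ, ?_⟩
    · exact isSplitMono_of_retraction hX f ρ hρ (fun m => congr(($hr).hom.f (.ofNat (m + 1)))) h₀
    · calc (Z.obj.d 0 1 ≫ ρ 0) ≫ X.obj.d 1 2
        _ = Z.obj.d 0 1 ≫ Z.obj.d 1 2 ≫ ρ 1 := (Category.assoc _ _ _).trans congr(_ ≫ $(hρ 0))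
        _ = 0 := by rw [Z.obj.d_comp_d_assoc, zero_comp]
  · right
    obtain ⟨h, hh⟩ := hf.2 f' hf'
    exact ⟨h ≫ c, h.hom.f 0, by rw [← Category.assoc, hh, hf'c], rfl⟩

end Complexes

section AlmostSplitSequences

variable {A : Type u} [Ring A]

theorem IsConflation.exists_g_comp_eq {a b : ℤ} {S : ShortComplex (BoundedProjComplex A a b)}
    (hS : IsConflation S) {W : BoundedProjComplex A a b} {k : S.X₂ ⟶ W} (hk : S.f ≫ k = 0) :
    ∃ t : S.X₃ ⟶ W, S.g ≫ t = k := by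
  have := hS.epi_g
  exact ⟨ObjectProperty.homMk (hS.exact.desc k.hom congr(($hk).hom)),
    ObjectProperty.hom_ext _ (hS.exact.g_desc _ _)⟩

theorem IsConflation.isIso_g_f {a b : ℤ} {S : ShortComplex (BoundedProjComplex A a b)}
    (hS : IsConflation S) {i : ℤ} (hi : IsZero (S.X₁.obj.X i)) : IsIso (S.g.hom.f i) := by
  have hSi := hS.map_of_exact (HomologicalComplex.eval (ModuleCat.{u} A) (ComplexShape.up ℤ) i)
  have hepi : Epi (S.g.hom.f i) := hSi.epi_g
  have hmono : Mono (S.g.hom.f i) := hSi.exact.mono_g (hi.eq_of_src _ _)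
  exact isIso_of_mono_of_epi _

theorem IsAlmostSplitSequence.isLeftMinimal {a b : ℤ}
    {S : ShortComplex (BoundedProjComplex A a b)} (hS : IsAlmostSplitSequence S) :
    IsLeftMinimal S.f := by
  intro e he
  obtain ⟨t, ht⟩ := hS.conflation.exists_g_comp_eq (k := 𝟙 S.X₂ - e)
    (by rw [Preadditive.comp_sub, he, Category.comp_id, sub_self])
  have := hS.right.isIso_id_sub_comp t
  have hiso := isIso_id_sub_comp_comm S.g t
  rwa [ht, sub_sub_cancel] at hiso

end AlmostSplitSequences

section SocleOfKernel

variable {A : Type u} [Ring A] [IsArtinianRing A] {n : ℕ} {X Z : BoundedProjComplex A 0 n}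
  {P : ModuleCat.{u} A} {p : P ⟶ socKerOne X} {f : X ⟶ Z}

theorem IsLeftAlmostSplit.isDirectSummand_X_zero (hf : IsLeftAlmostSplit f)
    (hX : IsZero (X.obj.X 0)) (hp : IsProjectiveCover p) {Q : ModuleCat.{u} A}
    (hQ : Indecomposable Q) (hQP : IsDirectSummand Q P) : IsDirectSummand Q (Z.obj.X 0) := by
  have := (X.property.1 1).1
  have := hp.finite
  have := hp.projective
  have := hQP.finite
  have := hQP.projective
  have := (Z.property.1 0).2
  obtain ⟨q, hq⟩ := (hp.isDirectSummand_iff hQ).1 hQP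
  have := IsSimpleModule.nontrivial A (LinearMap.range q)
  have hq₀ := LinearMap.ne_zero_of_surjective q.surjective_rangeRestrict
  let q₁ : Q ⟶ X.obj.X 1 := ModuleCat.ofHom ((LinearMap.ker (X.obj.d 1 2).hom).subtype ∘ₗ q)
  obtain ⟨h, hh⟩ := hf.exists_comp_ne_zero hX (q := q₁)
    (ModuleCat.hom_ext (LinearMap.ext fun x => (q x).2))
    fun h₀ => hq₀ (LinearMap.ext fun x => Subtype.ext (Subtype.ext congr($h₀ x)))
  refine isDirectSummand_of_ne_zero_of_isSimpleModule hQ hq₀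
    (ρ := q.rangeRestrict ∘ₗ h.hom) fun h₀ => hh ?_
  exact ModuleCat.hom_ext (LinearMap.ext fun x =>
    congr(((($h₀) x : LinearMap.ker (X.obj.d 1 2).hom) : X.obj.X 1)))

/-- Let `ν` be a map from a finite free module onto `N`. By left minimality, an endomorphism of `Z`
fixing `f` is onto in degree `0`, so it cannot factor through `ν` there. -/
theorem IsLeftAlmostSplit.exists_ne_zero_le_ker (hf : IsLeftAlmostSplit f)
    (hmin : IsLeftMinimal f) (hX : IsZero (X.obj.X 0)) {N : Submodule A (Z.obj.X 0)}
    (hN : N ≠ ⊤) :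
    ∃ φ : Z.obj.X 0 →ₗ[A] LinearMap.ker (X.obj.d 1 2).hom, φ ≠ 0 ∧ N ≤ LinearMap.ker φ := by
  have := (Z.property.1 0).1
  obtain ⟨k, s, hs⟩ := Module.Finite.exists_fin' A N
  let ν : ModuleCat.of A (Fin k → A) ⟶ Z.obj.X 0 := ModuleCat.ofHom (N.subtype ∘ₗ s)
  obtain ⟨φ, hφ, hνφ, hφd⟩ | ⟨e, l, he, hl⟩ := hf.exists_ne_zero_or_factors hX ν
  · refine ⟨φ.hom.codRestrict _ fun x => congr($hφd x), fun h₀ => hφ ?_, fun x hx => ?_⟩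
    · exact ModuleCat.hom_ext (LinearMap.ext fun x => congr((($h₀ x) : X.obj.X 1)))
    · obtain ⟨y, hy⟩ := hs ⟨x, hx⟩
      have hyx : ν y = x := congr(N.subtype $hy)
      exact Subtype.ext (hyx ▸ congr($hνφ y))
  · have := hmin e he
    refine absurd (eq_top_iff.2 fun x _ => ?_) hN
    have he₀ : inv e ≫ e = 𝟙 Z := IsIso.inv_hom_id e
    let y : Z.obj.X 0 := (inv e).hom.f 0 x
    have hy : e.hom.f 0 y = x := congr(($he₀).hom.f 0 x)
    have hly : N.subtype (s (l y)) = e.hom.f 0 y := congr($hl y)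
    exact hy ▸ hly ▸ (s (l y)).2

theorem IsLeftAlmostSplit.inAdd_X_zero (hf : IsLeftAlmostSplit f) (hmin : IsLeftMinimal f)
    (hX : IsZero (X.obj.X 0)) (hp : IsProjectiveCover p) : InAdd P (Z.obj.X 0) := by
  have := (Z.property.1 0).1
  have := (Z.property.1 0).2
  refine InAdd.of_forall_indecomposable fun Q hQ hQZ => ?_
  have := hQZ.finite
  have := hQZ.projective
  have := (indecomposable_iff_isCompl.1 hQ).1
  obtain ⟨t⟩ := hQZ
  obtain ⟨N, hN⟩ := IsCoatomic.exists_coatom (Submodule A Q)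
  have hr : Function.Surjective t.r.hom := fun x => ⟨t.i x, congr($(t.retract) x)⟩
  obtain ⟨φ, hφ, hker⟩ := hf.exists_ne_zero_le_ker hmin hX (N := N.comap t.r.hom) fun h =>
    hN.1 (Submodule.comap_injective_of_surjective hr (h.trans (Submodule.comap_top _).symm))
  have hri (x : Q) : t.r (t.i x) = x := congr($(t.retract) x)
  let q := φ ∘ₗ t.i.hom
  have hNq : N ≤ LinearMap.ker q := fun x hx => hker (show t.r (t.i x) ∈ N from (hri x).symm ▸ hx)
  have hq : LinearMap.ker q ≠ ⊤ := fun h => hφ <| LinearMap.ext fun z => by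
    have hz : t.r (z - t.i (t.r z)) = 0 := by rw [map_sub, hri, sub_self]
    have hφz : φ (z - t.i (t.r z)) = 0 := hker (show _ ∈ N from hz ▸ N.zero_mem)
    have hqz : φ (t.i (t.r z)) = 0 := LinearMap.congr_fun (LinearMap.ker_eq_top.1 h) (t.r z)
    rwa [map_sub, hqz, sub_zero] at hφz
  have := isSimpleModule_iff_isCoatom.2 ((hN.le_iff.1 hNq).resolve_left hq ▸ hN)
  exact (hp.isDirectSummand_iff hQ).2 ⟨q, IsSimpleModule.congr q.quotKerEquivRange.symm⟩

end SocleOfKernel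

theorem mainTheorem5_general {A : Type u} [Ring A] [IsArtinianRing A] (n : ℕ)
    (X : BoundedProjComplex A 1 n) (P : ModuleCat.{u} A) (p : P ⟶ socKerOne X)
    (hp : IsProjectiveCover p) :
    (∀ (Z : BoundedProjComplex A 0 n) (f : (inclZero A n).obj X ⟶ Z), IsLeftAlmostSplit f →
      ∀ Q : ModuleCat.{u} A, Indecomposable Q → IsDirectSummand Q P →
        IsDirectSummand Q (Z.obj.X 0)) ∧
    ∀ Y : BoundedProjComplex A 0 n, IsInverseTranslate ((inclZero A n).obj X) Y →
      InAdd P (Y.obj.X 0) := by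
  refine ⟨fun Z f hf Q hQ hQP => hf.isDirectSummand_X_zero (isZero_X_zero X) hp hQ hQP, ?_⟩
  rintro Y ⟨E, f, g, hfg, hS⟩
  have hE : InAdd P (E.obj.X 0) := hS.left.inAdd_X_zero hS.isLeftMinimal (isZero_X_zero X) hp
  have : IsIso (g.hom.f 0) := hS.conflation.isIso_g_f (isZero_X_zero X)
  exact hE.of_iso (asIso (g.hom.f 0))

theorem mainTheorem5 {R : Type v} [CommRing R] [IsArtinianRing R]
    {A : Type u} [Ring A] [Algebra R A] [Module.Finite R A]
    (n : ℕ) (hn : 1 ≤ n)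
    (X : BoundedProjComplex A 1 n) (hX : Indecomposable X)
    (P : ModuleCat.{u} A) (p : P ⟶ socKerOne X) (hp : IsProjectiveCover p) :
    (∀ (Z : BoundedProjComplex A 0 n) (f : (inclZero A n).obj X ⟶ Z), IsLeftAlmostSplit f →
      ∀ Q : ModuleCat.{u} A, Indecomposable Q → IsDirectSummand Q P →
        IsDirectSummand Q (Z.obj.X 0)) ∧
    (¬ IsInjectiveComplex ((inclZero A n).obj X) →
      ∀ Y : BoundedProjComplex A 0 n, IsInverseTranslate ((inclZero A n).obj X) Y →
        InAdd P (Y.obj.X 0)) := by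
  have : IsArtinianRing A := IsArtinianRing.of_finite R A
  have h := mainTheorem5_general n X P p hp
  exact ⟨h.1, fun _ => h.2⟩
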